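/- Let $d\ge 1$ and $n,m\ge 0$ be integers, and let $\mathcal S$ be a set of unit vectors of a finite-dimensional Hilbert space $H$. A probabilistic $n$-to-$m$ cloning oracle for $\mathcal S$ consists of a success probability $p\in(0,1]$, an arbitrary (not necessarily linear or positive) map $\mathcal R$ which sends each $|\psi\rangle\langle\psi|^{\otimes n}$, $\psi\in\mathcal S$, to a density operator on $H^{\otimes m}$, and an operator $\rho_\perp$ on $H^{\otimes m}$ (the output on failure). Its output on $X$ is $$\mathcal C(X)=p\,\mathcal R(X)\otimes|0\rangle\langle 0|+(1-p)\,\rho_\perp\otimes|1\rangle\langle 1| .$$ Let Alice and Bob share a density operator $\rho$ on $H^{\otimes n}\otimes\mathbb C^{b}$, let Bob measure a finite POVM $M=(M_x)_x$ on $\mathbb C^b$, and put $q_x=\operatorname{Tr}[\rho(\mathbb 1\otimes M_x)]$ and, for $q_x\neq 0$, $\rho_x=q_x^{-1}\operatorname{Tr}_B[\rho(\mathbb 1\otimes M_x)]$. We say that $M$ remotely prepares $n$ identical copies from $\mathcal S$ if every $\rho_x$ with $q_x\ne0$ has the form $|\psi\rangle\langle\psi|^{\otimes n}$ with $\psi\in\mathcal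 S$. The oracle is no-signalling if, for all $b$ and $\rho$, the final state $\sum_{x:\,q_x\neq 0} q_x\,\mathcal C(\rho_x)$ of Alice is the same for any two finite POVMs of Bob that remotely prepare $n$ identical copies from $\mathcal S$. The worst case global cloning fidelity is $$F_{\rm wc}(\mathcal R)=\inf_{\psi\in\mathcal S}F\big(\mathcal R(|\psi\rangle\langle\psi|^{\otimes n}),|\psi\rangle\langle\psi|^{\otimes m}\big),\qquad F(\rho,\sigma)=\big(\operatorname{Tr}|\sqrt\rho\sqrt\sigma|\big)^2 .$$ Theorem. Let $\mathcal S$ be either the set of $d$-dimensional multi-phase states $$\mathcal M(d)=\Big\{\tfrac1{\sqrt d}\sum_{i=1}^d e^{\mathrm i\theta_i}|i\rangle:\theta\in[0,2\pi)^d\Big\}\subset\mathbb C^d,$$ or the set of Choi states $$\mathcal J_{\mathcal T(d)}=\Big\{\tfrac1{\sqrt d}\sum_{i=1}^d V|i\rangle\otimes|i\rangle: V\in\mathcal T(d)\Big\}\subset\mathbb C^d\otimes\mathbb C^d$$ of the multi-phase unitaries $\mathcal T(d)=\{\sum_i e^{\mathrm i\theta_i}|i\rangle\langle i|:\theta\in[0,2\pi)^d\}$.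 Then every no-signalling probabilistic $n$-to-$m$ cloning oracle for $\mathcal S$ satisfies $$F_{\rm wc}(\mathcal R)\le\sum_{\nu}\frac1{d^m}\,\frac{m!}{\beta^\nu!},\qquad \beta!:=\beta_1!\cdots\beta_d!.$$ Here $\nu$ ranges over those residue vectors in $(\mathbb Z/(n+1)\mathbb Z)^d$ for which there is a $\beta\in\mathbb Z_{\ge0}^d$ with $\sum_i\beta_i=m$ and $\beta\equiv\nu\pmod{n+1}$, and $\beta^\nu$ is any such $\beta$ with the largest multinomial coefficient $m!/\beta!$. -/

import Mathlib

open scoped Kronecker MatrixOrder ComplexOrder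

noncomputable section

namespace NoCloning

open Matrix

/-- The matrix of the `n`-fold tensor power `M^{⊗ n}`; the standard basis of `(ℂ^ι)^{⊗ n}` is
indexed by `Fin n → ι`. -/
def tensorPow {ι : Type*} (n : ℕ) (M : Matrix ι ι ℂ) : Matrix (Fin n → ι) (Fin n → ι) ℂ :=
  Matrix.of fun a b => ∏ k, M (a k) (b k)

/-- The operator `|ψ⟩⟨ψ|`. -/
def proj {ι : Type*} (ψ : ι → ℂ) : Matrix ι ι ℂ := vecMulVec ψ (star ψ)

/-- The state `|ψ⟩⟨ψ|^{⊗ n}` of `n` identical copies of `ψ`. -/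
def copies {ι : Type*} (n : ℕ) (ψ : ι → ℂ) : Matrix (Fin n → ι) (Fin n → ι) ℂ :=
  tensorPow n (proj ψ)

/-- Density operators (quantum states): positive semidefinite matrices of trace one. -/
def IsDensity {α : Type*} [Fintype α] (ρ : Matrix α α ℂ) : Prop :=
  ρ.PosSemidef ∧ ρ.trace = 1

/-- The Uhlmann fidelity `F(ρ, σ) = (Tr |√ρ √σ|)²`. -/
def fidelity {α : Type*} [Fintype α] [DecidableEq α] (ρ σ : Matrix α α ℂ) : ℝ :=
  (CFC.abs (CFC.sqrt ρ * CFC.sqrt σ)).trace.re ^ 2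

/-- A probabilistic `n`-to-`m` cloning oracle for a set `S` of pure states of `ℂ^ι`. It succeeds
with a fixed nonzero probability `p`, and then sends `|ψ⟩⟨ψ|^{⊗ n}` to `R (|ψ⟩⟨ψ|^{⊗ n})`, which has
to be a quantum state when `ψ ∈ S`. Neither linearity nor positivity is required of `R`, and its
values on other inputs are irrelevant; nothing is required of the output on failure. -/
structure CloningOracle {ι : Type*} [Fintype ι] [DecidableEq ι] (S : Set (ι → ℂ)) (n m : ℕ) where
  /-- the success probability -/
  p : ℝ
  p_pos : 0 < p
  p_le_one : p ≤ 1
  /-- the map performed in case of success -/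
  R : Matrix (Fin n → ι) (Fin n → ι) ℂ → Matrix (Fin m → ι) (Fin m → ι) ℂ
  R_isDensity : ∀ ψ ∈ S, IsDensity (R (copies n ψ))
  /-- the output in case of failure -/
  rhoFail : Matrix (Fin m → ι) (Fin m → ι) ℂ

namespace CloningOracle

variable {ι : Type*} [Fintype ι] [DecidableEq ι] {S : Set (ι → ℂ)} {n m : ℕ}

/-- The full output `p R(X) ⊗ |0⟩⟨0| + (1 - p) ρ_⊥ ⊗ |1⟩⟨1|` of the oracle; the second tensor
factor is the flag that tells success (`0`) from failure (`1`). -/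
def output (C : CloningOracle S n m) (X : Matrix (Fin n → ι) (Fin n → ι) ℂ) :
    Matrix ((Fin m → ι) × Fin 2) ((Fin m → ι) × Fin 2) ℂ :=
  (C.p : ℂ) • (C.R X ⊗ₖ Matrix.single 0 0 1) +
    (1 - C.p : ℂ) • (C.rhoFail ⊗ₖ Matrix.single 1 1 1)

/-- The worst case global cloning fidelity
`F_wc(R) = inf_{ψ ∈ S} F(R(|ψ⟩⟨ψ|^{⊗ n}), |ψ⟩⟨ψ|^{⊗ m})`. -/
def worstCaseFidelity (C : CloningOracle S n m) : ℝ :=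
  ⨅ ψ : S, fidelity (C.R (copies n ψ.1)) (copies m ψ.1)

end CloningOracle

/-- A positive operator-valued measure with finitely many outcomes. -/
def IsPOVM {κ β : Type*} [Fintype κ] [Fintype β] [DecidableEq β] (M : κ → Matrix β β ℂ) : Prop :=
  (∀ x, (M x).PosSemidef) ∧ ∑ x, M x = 1

/-- The unnormalized state `Tr_B[ρ (𝟙 ⊗ E)]` in which Alice's system `A` is left when Bob, who
holds the system `B` of the shared state `ρ`, obtains an outcome with POVM element `E`. Its trace
is the probability of the outcome. -/
def conditionalState {α β : Type*} [Fintype β] (ρ : Matrix (α × β) (α × β) ℂ)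
    (E : Matrix β β ℂ) : Matrix α α ℂ :=
  Matrix.of fun a a' => ∑ b, ∑ b', ρ (a, b) (a', b') * E b' b

/-- By measuring `M` on his part of the shared state `ρ`, Bob remotely prepares `n` identical
copies of states from `S` for Alice: given any outcome of nonzero probability, her state is
`|ψ⟩⟨ψ|^{⊗ n}` for some `ψ ∈ S`. -/
def RemotelyPrepares {ι κ β : Type*} [Fintype ι] [Fintype β] (S : Set (ι → ℂ)) (n : ℕ)
    (ρ : Matrix ((Fin n → ι) × β) ((Fin n → ι) × β) ℂ) (M : κ → Matrix β β ℂ) : Prop :=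
  ∀ x, (conditionalState ρ (M x)).trace ≠ 0 → ∃ ψ ∈ S,
    (conditionalState ρ (M x)).trace⁻¹ • conditionalState ρ (M x) = copies n ψ

/-- Alice's final state, for a Bob who measures `M` and does not tell her the outcome, when she
feeds her part of the shared state `ρ` into the oracle: the average of the oracle's output on her
normalized conditional states, weighted with the probabilities of the outcomes. -/
def CloningOracle.aliceState {ι κ β : Type*} [Fintype ι] [DecidableEq ι] [Fintype κ] [Fintype β]
    {S : Set (ι → ℂ)} {n m : ℕ} (C : CloningOracle S n m)
    (ρ : Matrix ((Fin n → ι) × β) ((Fin n → ι) × β) ℂ) (M : κ → Matrix β β ℂ) :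
    Matrix ((Fin m → ι) × Fin 2) ((Fin m → ι) × Fin 2) ℂ :=
  ∑ x, (conditionalState ρ (M x)).trace •
    C.output ((conditionalState ρ (M x)).trace⁻¹ • conditionalState ρ (M x))

/-- The no-signalling principle for Alice's use of a cloning oracle: whatever state Alice and Bob
share, two measurements of Bob that both prepare inputs of the oracle for Alice leave her with the
same final state, so that Bob cannot signal to her by his choice of measurement. -/
def CloningOracle.NoSignalling {ι : Type*} [Fintype ι] [DecidableEq ι]
    {S : Set (ι → ℂ)} {n m : ℕ} (C : CloningOracle S n m) : Prop :=
  ∀ (b k l : ℕ) (ρ : Matrix ((Fin n → ι) × Fin b) ((Fin n → ι) × Fin b) ℂ)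
    (M : Fin k → Matrix (Fin b) (Fin b) ℂ) (N : Fin l → Matrix (Fin b) (Fin b) ℂ),
    IsDensity ρ → IsPOVM M → IsPOVM N →
    RemotelyPrepares S n ρ M → RemotelyPrepares S n ρ N →
    C.aliceState ρ M = C.aliceState ρ N

/-- The multi-phase states `d^{-1/2} ∑ᵢ e^{iθᵢ} |i⟩`, `θ ∈ [0, 2π)^d`. -/
def multiPhaseStates (d : ℕ) : Set (Fin d → ℂ) :=
  {ψ | ∃ θ : Fin d → ℝ, (∀ i, θ i ∈ Set.Ico 0 (2 * Real.pi)) ∧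
    ψ = fun i => (1 / Real.sqrt d : ℂ) * Complex.exp (Complex.I * θ i)}

/-- The multi-phase unitaries `∑ᵢ e^{iθᵢ} |i⟩⟨i|`, `θ ∈ [0, 2π)^d`. -/
def multiPhaseUnitaries (d : ℕ) : Set (Matrix (Fin d) (Fin d) ℂ) :=
  {V | ∃ θ : Fin d → ℝ, (∀ i, θ i ∈ Set.Ico 0 (2 * Real.pi)) ∧
    V = Matrix.diagonal fun i => Complex.exp (Complex.I * θ i)}

/-- The Choi state `d^{-1/2} ∑ᵢ V|i⟩ ⊗ |i⟩` of a unitary `V`, a vector of `ℂ^d ⊗ ℂ^d`. -/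
def choiState {d : ℕ} (V : Matrix (Fin d) (Fin d) ℂ) : Fin d × Fin d → ℂ :=
  fun x => (1 / Real.sqrt d : ℂ) * V x.1 x.2

/-- The Choi states of the multi-phase unitaries. -/
def multiPhaseChoiStates (d : ℕ) : Set (Fin d × Fin d → ℂ) :=
  choiState '' multiPhaseUnitaries d

/-- The multinomial coefficient `m!/β!` with `β! = ∏ᵢ βᵢ!`, as a real number. -/
def multinom {d : ℕ} (m : ℕ) (β : Fin d → ℕ) : ℝ :=
  (m.factorial : ℝ) / ∏ i, ((β i).factorial : ℝ)

/-- The residue vector `β mod (n + 1)`. -/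
def residue {d : ℕ} (n : ℕ) (β : Fin d → ℕ) : Fin d → ZMod (n + 1) :=
  fun i => (β i : ZMod (n + 1))

/-- The `β ∈ ℕ^d` with `∑ᵢ βᵢ = m` and `β ≡ ν mod (n + 1)`. -/
def residueClass {d : ℕ} (n m : ℕ) (ν : Fin d → ZMod (n + 1)) : Set (Fin d → ℕ) :=
  {β | ∑ i, β i = m ∧ residue n β = ν}

/-- The `ν ∈ (ℤ/(n + 1))^d` for which some `β ∈ ℕ^d` with `∑ᵢ βᵢ = m` satisfies
`β ≡ ν mod (n + 1)`. -/
def residues (d n m : ℕ) : Finset (Fin d → ZMod (n + 1)) :=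
  (Finset.piAntidiag Finset.univ m).image (residue n)

/-- `B` selects, for every occurring residue `ν`, some
`B ν = β^ν ∈ argmax {m!/β! : ∑ᵢ βᵢ = m, β ≡ ν mod (n + 1)}`. -/
def IsArgmaxSelection {d : ℕ} (n m : ℕ) (B : (Fin d → ZMod (n + 1)) → Fin d → ℕ) : Prop :=
  ∀ ν ∈ residues d n m,
    B ν ∈ residueClass n m ν ∧ ∀ β ∈ residueClass n m ν, multinom m β ≤ multinom m (B ν)

end NoCloning

end

/-!
Both sets of states consist of the phase states `d^{-1/2} ∑ᵢ zᵢ |e i⟩`, `|zᵢ| = 1`, for an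
orthonormal system `|e i⟩` (`|i⟩` or `|i⟩ ⊗ |i⟩`), so it suffices to bound the fidelity for phase
states (`CloningOracle.NoSignalling.worstCaseFidelity_le`). The worst case is at most the average
over any finite set of phases; the set used consists of vectors of `N`-th roots of unity with `N =
(n + 1) (m + 1)`.

In `n` copies of a phase state, the sequence `a` has amplitude `d^{-n/2} z^α`, where `α` is the
type of `a` (how often each letter occurs). The entries of `α` are at most `n`, so the monomials
`z^α` are orthogonal already on a coset of the group `K` of vectors of `(n + 1)`-th roots of
unity. Hence from the state `d^{-n/2} ∑ₐ |a⟩ ⊗ |type of a⟩` Bob can steer, by measuring in a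
shifted Fourier basis, to the uniform ensemble on any coset of `K`, and by the no-signalling
principle the average output of the oracle on such an ensemble does not depend on the coset
(`CloningOracle.NoSignalling.sum_R_coarseShift_eq`).

Undo the phases of the `m` target copies in the output and average over all phases; let `G` be the
resulting positive matrix, indexed by sequences of length `m`. The average fidelity is `d^{-m}`
times the sum of all entries of `G`. If the types `β ≠ β'` of two sequences agree modulo `n + 1`,
their relative phase `z^{β' - β}` is constant on the cosets of `K`, so the corresponding entry of
`G` is the coset-independent average output times the average of `z^{β' - β}`, which is zero
(`CloningOracle.NoSignalling.twirl_apply_eq_zero`). Thus in every residue class `G` is block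
diagonal with respect to the types. By the Cauchy–Schwarz inequality within a type, of which there
are `m!/β!` sequences, and by a weighted Cauchy–Schwarz inequality between the residue classes,
with the largest multinomial coefficients of the classes as weights, the sum of all entries is at
most `∑_ν m!/β^ν!` times the trace (`Matrix.PosSemidef.re_sum_sum_le_mul_trace`).
-/

open scoped Kronecker MatrixOrder ComplexOrder

namespace NoCloning

open Matrix

/-! ### Fidelity with a pure state -/

/-- The fidelity with a pure state `|v⟩⟨v|` is the expectation `⟨v|ρ|v⟩`: the projection is its own
square root, and `|√ρ |v⟩⟨v|| = √⟨v|ρ|v⟩ |v⟩⟨v|`. -/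
lemma fidelity_proj {α : Type*} [Fintype α] [DecidableEq α] {ρ : Matrix α α ℂ}
    (hρ : ρ.PosSemidef) {v : α → ℂ} (hv : star v ⬝ᵥ v = 1) :
    fidelity ρ (proj v) = (star v ⬝ᵥ ρ *ᵥ v).re := by
  have hP : proj v * proj v = proj v := by
    rw [proj, vecMulVec_mul_vecMulVec, hv, one_smul]
  have hP0 : (0 : Matrix α α ℂ) ≤ proj v :=
    Matrix.nonneg_iff_posSemidef.2 (posSemidef_vecMulVec_self_star v)
  have hsP : CFC.sqrt (proj v) = proj v := CFC.sqrt_unique hP hP0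
  have hPs : star (proj v) = proj v :=
    (posSemidef_vecMulVec_self_star v).isHermitian
  have hρ0 : (0 : Matrix α α ℂ) ≤ ρ := Matrix.nonneg_iff_posSemidef.2 hρ
  have hq : 0 ≤ star v ⬝ᵥ ρ *ᵥ v := hρ.dotProduct_mulVec_nonneg v
  obtain ⟨hq0, hqi⟩ := Complex.nonneg_iff.1 hq
  set q := (star v ⬝ᵥ ρ *ᵥ v).re with hqdef
  have hqq : star v ⬝ᵥ ρ *ᵥ v = (q : ℂ) := Complex.ext rfl (by simpa using hqi.symm)
  have hs : star (CFC.sqrt ρ) = CFC.sqrt ρ :=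
    (Matrix.nonneg_iff_posSemidef.1 (CFC.sqrt_nonneg ρ)).isHermitian
  have habs : CFC.abs (CFC.sqrt ρ * CFC.sqrt (proj v)) = (Real.sqrt q : ℂ) • proj v := by
    apply CFC.sqrt_unique
    · rw [hsP, star_mul, hPs, hs, mul_assoc, ← mul_assoc (CFC.sqrt ρ),
        CFC.sqrt_mul_sqrt_self ρ hρ0, smul_mul_smul_comm, hP, ← Complex.ofReal_mul,
        Real.mul_self_sqrt hq0, proj, mul_vecMulVec, vecMulVec_mul_vecMulVec, hqq]
      ext
      simp [vecMulVec_apply, mul_left_comm]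
    · exact smul_nonneg (by simp) hP0
  rw [fidelity, habs, trace_smul, proj, trace_vecMulVec, dotProduct_comm, hv]
  simp [Real.sq_sqrt hq0]

/-! ### Types of sequences -/

/-- The type of a sequence `a` over the alphabet `Fin d`: the vector that counts how often each
letter occurs in `a`. -/
def seqType {d m : ℕ} (a : Fin m → Fin d) : Fin d → ℕ := fun i => Fintype.card {k // a k = i}

lemma sum_seqType {d m : ℕ} (a : Fin m → Fin d) : ∑ i, seqType a i = m := by
  simp only [seqType]
  rw [← Fintype.card_sigma, Fintype.card_congr (Equiv.sigmaFiberEquiv a), Fintype.card_fin]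

lemma seqType_le {d m : ℕ} (a : Fin m → Fin d) (i : Fin d) : seqType a i ≤ m :=
  (Finset.single_le_sum (fun _ _ => Nat.zero_le _) (Finset.mem_univ i)).trans (sum_seqType a).le

lemma prod_comp_eq_prod_pow_seqType {d m : ℕ} {M : Type*} [CommMonoid M] (z : Fin d → M)
    (a : Fin m → Fin d) : ∏ k, z (a k) = ∏ i, z i ^ seqType a i := by
  rw [Finset.prod_comp z a]
  refine Finset.prod_subset_one_on_sdiff (Finset.subset_univ _) ?_ ?_
  · intro i hi
    simp only [Finset.mem_sdiff, Finset.mem_univ, Finset.mem_image,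
      true_and, not_exists] at hi
    simp [seqType, hi]
  · intro i _
    rw [seqType, Fintype.card_subtype]

/-- The number of sequences of type `β` is the multinomial coefficient, as both are the
coefficient of `X^β` in `(∑ᵢ Xᵢ)^m`. -/
lemma card_seqType_eq {d m : ℕ} {β : Fin d → ℕ} (hβ : ∑ i, β i = m) :
    (Fintype.card {a : Fin m → Fin d // seqType a = β} : ℝ) = multinom m β := by
  have h := MvPolynomial.coeff_sum_X_pow_of_fintype (R := ℝ) (σ := Fin d)
    (Finsupp.equivFunOnFinite.symm β) m
  rw [if_pos (by simpa [Finsupp.sum_fintype] using hβ), Fintype.sum_pow,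
    MvPolynomial.coeff_sum,
    Finsupp.multinomial_eq_of_support_subset (Finset.subset_univ _)] at h
  have hc (a : Fin m → Fin d) : MvPolynomial.coeff (Finsupp.equivFunOnFinite.symm β)
      (∏ k, (MvPolynomial.X (a k) : MvPolynomial (Fin d) ℝ)) =
        if seqType a = β then 1 else 0 := by
    have := MvPolynomial.monomial_finsupp_sum_index (R := ℝ)
      (Finsupp.equivFunOnFinite.symm (seqType a)) (fun i k => Finsupp.single i k) 1
    rw [Finsupp.sum_single] at this
    rw [prod_comp_eq_prod_pow_seqType]
    simp only [MvPolynomial.C_1, one_mul] at this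
    rw [Finsupp.prod_fintype _ _ (by simp)] at this
    simp only [MvPolynomial.X_pow_eq_monomial]
    simp only [Finsupp.equivFunOnFinite_symm_apply_apply] at this
    rw [← this, MvPolynomial.coeff_monomial]
    simp
  simp only [hc] at h
  rw [multinom, Fintype.card_subtype]
  rw [Finset.sum_boole] at h
  rw [h, eq_div_iff (by positivity)]
  have := Nat.multinomial_spec Finset.univ β
  rw [hβ] at this
  rw [← this]
  push_cast
  rw [mul_comm]
  rfl

/-! ### Positive semidefinite matrices with vanishing blocks -/

/-- Cauchy–Schwarz with weights: for a positive semidefinite `G` and a partition of the indices into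
blocks `f a = ν`, the sum of all entries is controlled by the sums over the diagonal blocks. -/
lemma _root_.Matrix.PosSemidef.re_sum_sum_le {A Z : Type*} [Fintype A] [DecidableEq A]
    [DecidableEq Z] {G : Matrix A A ℂ} (hG : G.PosSemidef) (f : A → Z) (s : Finset Z)
    (hf : ∀ a, f a ∈ s) (w : Z → ℝ) (hw : ∀ ν ∈ s, 0 < w ν) :
    (∑ a, ∑ b, G a b).re ≤
      (∑ ν ∈ s, w ν) * ∑ ν ∈ s, (∑ a with f a = ν, ∑ b with f b = ν, G a b).re / w ν := by
  obtain ⟨X, rfl⟩ : ∃ X, G = star X * X :=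
    CStarAlgebra.nonneg_iff_eq_star_mul_self.1 (Matrix.nonneg_iff_posSemidef.2 hG)
  have key (P : Finset A) :
      (∑ a ∈ P, ∑ b ∈ P, (star X * X) a b).re = ∑ c, ‖∑ a ∈ P, X c a‖ ^ 2 := by
    have : ∑ a ∈ P, ∑ b ∈ P, (star X * X) a b =
        ∑ c, ((‖∑ a ∈ P, X c a‖ ^ 2 : ℝ) : ℂ) := by
      simp only [mul_apply, star_apply, Complex.ofReal_pow, ← Complex.conj_mul', map_sum,
        Finset.sum_mul_sum]
      rw [Finset.sum_comm_cycle]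
      rfl
    rw [this, ← Complex.ofReal_sum, Complex.ofReal_re]
  simp only [key, Finset.sum_div]
  rw [Finset.sum_comm, Finset.mul_sum]
  refine Finset.sum_le_sum fun c _ => ?_
  rw [← Finset.sum_fiberwise_of_maps_to (fun a _ => hf a) (X c)]
  refine (pow_le_pow_left₀ (norm_nonneg _) (norm_sum_le _ _) 2).trans ?_
  refine Finset.sum_sq_le_sum_mul_sum_of_sq_le_mul _ (fun ν hν => (hw ν hν).le)
    (fun ν hν => div_nonneg (sq_nonneg _) (hw ν hν).le) fun ν hν => ?_
  exact (mul_div_cancel₀ _ (hw ν hν).ne').ge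

/-- Two-level estimate: the indices are partitioned by `τ`, and more coarsely by `r ∘ τ`. If the
entries of `G` between different `τ`-blocks of the same `r ∘ τ`-block vanish, and `w` bounds the
sizes of the `τ`-blocks in each `r ∘ τ`-block, then the sum of the entries of `G` is at most
`(∑ w) Tr G`. -/
lemma _root_.Matrix.PosSemidef.re_sum_sum_le_mul_trace {A T Z : Type*} [Fintype A] [DecidableEq A]
    [DecidableEq T] [DecidableEq Z] {G : Matrix A A ℂ} (hG : G.PosSemidef) (τ : A → T) (r : T → Z)
    (s : Finset Z) (hs : ∀ a, r (τ a) ∈ s) (w : Z → ℝ) (hw : ∀ ν ∈ s, 0 < w ν)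
    (hcard : ∀ a, (Fintype.card {b // τ b = τ a} : ℝ) ≤ w (r (τ a)))
    (h0 : ∀ a b, r (τ a) = r (τ b) → τ a ≠ τ b → G a b = 0) :
    (∑ a, ∑ b, G a b).re ≤ (∑ ν ∈ s, w ν) * G.trace.re := by
  refine (hG.re_sum_sum_le (fun a => r (τ a)) s hs w hw).trans ?_
  refine mul_le_mul_of_nonneg_left ?_ (Finset.sum_nonneg fun ν hν => (hw ν hν).le)
  have hdiag (a : A) : 0 ≤ (G a a).re := (Complex.nonneg_iff.1 (hG.diag_nonneg (i := a))).1
  -- within one `τ`-block, the lemma above with blocks of size one and weight one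
  have hblock (β : T) : (∑ a with τ a = β, ∑ b with τ b = β, G a b).re ≤
      Fintype.card {b // τ b = β} * ∑ a with τ a = β, (G a a).re := by
    have h := (hG.submatrix (Subtype.val : {a // τ a = β} → A)).re_sum_sum_le id Finset.univ
      (by simp) (fun _ => 1) (by simp)
    simp only [id, Finset.filter_eq', Finset.mem_univ, if_true, Finset.sum_singleton, div_one,
      submatrix_apply, Finset.sum_const, nsmul_eq_mul, mul_one, Finset.card_univ] at h
    have e (F : A → ℂ) : ∑ a with τ a = β, F a = ∑ a : {a // τ a = β}, F a :=
      Finset.sum_subtype _ (by simp) _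
    have e' (F : A → ℝ) : ∑ a with τ a = β, F a = ∑ a : {a // τ a = β}, F a :=
      Finset.sum_subtype _ (by simp) _
    simpa only [e, e'] using h
  -- within one `r ∘ τ`-block, only the `τ`-blocks on the diagonal contribute
  have hclass (ν : Z) (hν : ν ∈ s) :
      (∑ a with r (τ a) = ν, ∑ b with r (τ b) = ν, G a b).re / w ν ≤
        ∑ a with r (τ a) = ν, (G a a).re := by
    rw [div_le_iff₀ (hw ν hν), mul_comm]
    have h1 : ∑ a with r (τ a) = ν, ∑ b with r (τ b) = ν, G a b =
        ∑ a with r (τ a) = ν, ∑ b with τ b = τ a, G a b := by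
      refine Finset.sum_congr rfl fun a ha => ?_
      rw [Finset.mem_filter_univ] at ha
      refine (Finset.sum_subset (fun b hb => ?_) fun b hb hb' => ?_).symm
      · rw [Finset.mem_filter_univ] at hb ⊢
        rw [hb, ha]
      · rw [Finset.mem_filter_univ] at hb hb'
        exact h0 a b (ha.trans hb.symm) (Ne.symm hb')
    have hmaps : ∀ a ∈ Finset.univ.filter (fun a => r (τ a) = ν),
        τ a ∈ (Finset.univ.filter (fun a => r (τ a) = ν)).image τ :=
      fun a ha => Finset.mem_image_of_mem τ ha
    rw [h1, ← Finset.sum_fiberwise_of_maps_to hmaps, ← Finset.sum_fiberwise_of_maps_to hmaps,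
      Finset.mul_sum, Complex.re_sum]
    refine Finset.sum_le_sum fun β hβ => ?_
    obtain ⟨a₀, ha₀, rfl⟩ := Finset.mem_image.1 hβ
    rw [Finset.mem_filter_univ] at ha₀
    have hfil : (Finset.univ.filter (fun a => r (τ a) = ν)).filter (fun a => τ a = τ a₀) =
        Finset.univ.filter (fun a => τ a = τ a₀) := by
      ext a
      simp only [Finset.mem_filter, Finset.mem_univ, true_and, and_iff_right_iff_imp]
      intro h
      rw [h, ha₀]
    rw [hfil]
    have h2 : ∑ a with τ a = τ a₀, ∑ b with τ b = τ a, G a b =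
        ∑ a with τ a = τ a₀, ∑ b with τ b = τ a₀, G a b := by
      refine Finset.sum_congr rfl fun a ha => ?_
      rw [(Finset.mem_filter_univ a).1 ha]
    rw [h2]
    refine (hblock _).trans (mul_le_mul_of_nonneg_right ?_ (Finset.sum_nonneg fun a _ => hdiag a))
    rw [← ha₀]
    exact hcard a₀
  refine (Finset.sum_le_sum hclass).trans_eq ?_
  rw [Finset.sum_fiberwise_of_maps_to (fun a _ => hs a), trace, Complex.re_sum]
  rfl

/-! ### Remote preparation of an ensemble -/

/-- The vector `ψ^{⊗ n}`. -/
def tensorVec {ι : Type*} (n : ℕ) (ψ : ι → ℂ) : (Fin n → ι) → ℂ := fun a => ∏ k, ψ (a k)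

lemma copies_eq_proj {ι : Type*} (n : ℕ) (ψ : ι → ℂ) : copies n ψ = proj (tensorVec n ψ) := by
  ext a b
  simp [copies, tensorPow, proj, vecMulVec_apply, tensorVec, Finset.prod_mul_distrib]

lemma star_tensorVec_dotProduct_self {ι : Type*} [Fintype ι] (n : ℕ) {ψ : ι → ℂ}
    (hψ : star ψ ⬝ᵥ ψ = 1) : star (tensorVec n ψ) ⬝ᵥ tensorVec n ψ = 1 := by
  classical
  have h := Fintype.sum_pow (fun i => star (ψ i) * ψ i) n
  have h' : ∑ i, star (ψ i) * ψ i = 1 := hψ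
  rw [h', one_pow] at h
  rw [h]
  simp [dotProduct, tensorVec, Finset.prod_mul_distrib]

lemma proj_smul {ι : Type*} (c : ℂ) (v : ι → ℂ) : proj (c • v) = (c * star c) • proj v := by
  ext a b
  simp [proj, vecMulVec_apply]
  ring

/-- If the shared state is pure and Bob finds the pure outcome `g`, Alice's state is pure. -/
lemma conditionalState_proj {α β : Type*} [Fintype β] (Ω : α × β → ℂ) (g : β → ℂ) :
    conditionalState (proj Ω) (proj g) = proj fun a => ∑ b, Ω (a, b) * star (g b) := by
  ext a a'
  simp only [conditionalState, proj, vecMulVec_apply, of_apply, Pi.star_apply, star_sum,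
    Finset.sum_mul_sum, star_mul', star_star]
  refine Finset.sum_congr rfl fun b _ => Finset.sum_congr rfl fun b' _ => ?_
  ring

section Steering

variable {ι : Type*} [Fintype ι] [DecidableEq ι] {S : Set (ι → ℂ)} {n m : ℕ}

lemma CloningOracle.output_apply_zero_zero (C : CloningOracle S n m)
    (X : Matrix (Fin n → ι) (Fin n → ι) ℂ) (a b : Fin m → ι) :
    C.output X (a, 0) (b, 0) = C.p * C.R X a b := by
  simp [CloningOracle.output, kroneckerMap_apply]

/-- Two uniform ensembles that Bob can prepare from the same pure state `Ω`, by the rank-one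
measurements `|g k⟩⟨g k|` and `|h k⟩⟨h k|`, have the same average under the map performed in case of
success. -/
lemma CloningOracle.NoSignalling.sum_R_eq {C : CloningOracle S n m} (hC : C.NoSignalling)
    {β κ : Type*} [Fintype β] [DecidableEq β] [Fintype κ] {Ω : (Fin n → ι) × β → ℂ}
    (hΩ : ∑ x, Ω x * star (Ω x) = 1) {g h : κ → β → ℂ} (hg : ∑ k, proj (g k) = 1)
    (hh : ∑ k, proj (h k) = 1) {ψ φ : κ → ι → ℂ} (hψ : ∀ k, ψ k ∈ S) (hφ : ∀ k, φ k ∈ S)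
    (hψ1 : ∀ k, star (ψ k) ⬝ᵥ ψ k = 1) (hφ1 : ∀ k, star (φ k) ⬝ᵥ φ k = 1) {c : ℂ} (hc : c ≠ 0)
    (hgψ : ∀ k a, ∑ b, Ω (a, b) * star (g k b) = c * tensorVec n (ψ k) a)
    (hhφ : ∀ k a, ∑ b, Ω (a, b) * star (h k b) = c * tensorVec n (φ k) a) :
    ∑ k, C.R (copies n (ψ k)) = ∑ k, C.R (copies n (φ k)) := by
  set eβ := Fintype.equivFin β
  set eκ := Fintype.equivFin κ
  set Ω' : (Fin n → ι) × Fin (Fintype.card β) → ℂ := fun x => Ω (x.1, eβ.symm x.2)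
  let M (g : κ → β → ℂ) (k : Fin (Fintype.card κ)) :
      Matrix (Fin (Fintype.card β)) (Fin (Fintype.card β)) ℂ :=
    proj fun b => g (eκ.symm k) (eβ.symm b)
  have hρ : IsDensity (proj Ω') := by
    refine ⟨posSemidef_vecMulVec_self_star _, ?_⟩
    rw [proj, trace_vecMulVec, ← hΩ]
    exact Equiv.sum_comp ((Equiv.refl _).prodCongr eβ.symm) fun x => Ω x * star (Ω x)
  have hM {g : κ → β → ℂ} (hg : ∑ k, proj (g k) = 1) : IsPOVM (M g) := by
    refine ⟨fun k => posSemidef_vecMulVec_self_star _, ?_⟩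
    have : ∑ k, M g k = (∑ k, proj (g k)).submatrix eβ.symm eβ.symm := by
      rw [← Equiv.sum_comp eκ.symm]
      ext b b'
      simp only [Matrix.sum_apply, submatrix_apply]
      rfl
    rw [this, hg, submatrix_one_equiv]
  have hcond {g : κ → β → ℂ} {ψ : κ → ι → ℂ}
      (hgψ : ∀ k a, ∑ b, Ω (a, b) * star (g k b) = c * tensorVec n (ψ k) a) (k) :
      conditionalState (proj Ω') (M g k) = (c * star c) • copies n (ψ (eκ.symm k)) := by
    rw [conditionalState_proj, copies_eq_proj, ← proj_smul]
    congr 1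
    ext a
    rw [Pi.smul_apply, smul_eq_mul, ← hgψ]
    exact Equiv.sum_comp eβ.symm fun b => Ω (a, b) * star (g (eκ.symm k) b)
  have hcc : c * star c ≠ 0 := mul_ne_zero hc (star_ne_zero.2 hc)
  have htr {ψ : κ → ι → ℂ} (hψ1 : ∀ k, star (ψ k) ⬝ᵥ ψ k = 1) (k) :
      ((c * star c) • copies n (ψ k)).trace = c * star c := by
    rw [trace_smul, copies_eq_proj, proj, trace_vecMulVec, dotProduct_comm,
      star_tensorVec_dotProduct_self n (hψ1 k), smul_eq_mul, mul_one]
  have hprep {g : κ → β → ℂ} {ψ : κ → ι → ℂ} (hψ : ∀ k, ψ k ∈ S)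
      (hψ1 : ∀ k, star (ψ k) ⬝ᵥ ψ k = 1)
      (hgψ : ∀ k a, ∑ b, Ω (a, b) * star (g k b) = c * tensorVec n (ψ k) a) :
      RemotelyPrepares S n (proj Ω') (M g) := by
    intro k _
    refine ⟨ψ (eκ.symm k), hψ _, ?_⟩
    rw [hcond hgψ, htr hψ1, inv_smul_smul₀ hcc]
  have hfin {g : κ → β → ℂ} {ψ : κ → ι → ℂ} (hψ1 : ∀ k, star (ψ k) ⬝ᵥ ψ k = 1)
      (hgψ : ∀ k a, ∑ b, Ω (a, b) * star (g k b) = c * tensorVec n (ψ k) a) (a b : Fin m → ι) :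
      C.aliceState (proj Ω') (M g) (a, 0) (b, 0) =
        c * star c * C.p * (∑ k, C.R (copies n (ψ k))) a b := by
    rw [CloningOracle.aliceState, ← Equiv.sum_comp eκ.symm, Matrix.sum_apply, Matrix.sum_apply,
      Finset.mul_sum]
    refine Finset.sum_congr rfl fun k _ => ?_
    rw [hcond hgψ, htr hψ1, inv_smul_smul₀ hcc, Matrix.smul_apply,
      C.output_apply_zero_zero, smul_eq_mul]
    ring
  have hsig := hC _ _ _ (proj Ω') (M g) (M h) hρ (hM hg) (hM hh) (hprep hψ hψ1 hgψ)
    (hprep hφ hφ1 hhφ)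
  -- the block of the final state flagged as success determines the average of `R`, as `p ≠ 0`
  have hp : (C.p : ℂ) ≠ 0 := Complex.ofReal_ne_zero.2 C.p_pos.ne'
  ext a b
  have hab := congrFun (congrFun hsig (a, 0)) (b, 0)
  rw [hfin hψ1 hgψ, hfin hφ1 hhφ] at hab
  exact mul_left_cancel₀ (mul_ne_zero hcc hp) hab

end Steering

/-! ### Phase states -/

/-- The vector `d^{-1/2} ∑ᵢ zᵢ |e i⟩` of `ℂ^ι`. For `|zᵢ| = 1` these are the multi-phase states when
`e` is the identity, and the Choi states of the multi-phase unitaries when `e i = (i, i)`. -/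
noncomputable def phaseState {ι : Type*} {d : ℕ} (e : Fin d → ι) (z : Fin d → ℂ) : ι → ℂ :=
  Function.extend e (fun i => (1 / Real.sqrt d : ℂ) * z i) 0

lemma tensorVec_phaseState_comp {ι : Type*} {d : ℕ} {e : Fin d → ι} (he : Function.Injective e)
    (z : Fin d → ℂ) (n : ℕ) (a : Fin n → Fin d) :
    tensorVec n (phaseState e z) (e ∘ a) =
      (1 / Real.sqrt d : ℂ) ^ n * ∏ i, z i ^ seqType a i := by
  rw [← prod_comp_eq_prod_pow_seqType]
  simp [tensorVec, phaseState, he.extend_apply, Finset.prod_mul_distrib]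

lemma tensorVec_phaseState_of_notMem_range {ι : Type*} {d : ℕ} (e : Fin d → ι) (z : Fin d → ℂ)
    {n : ℕ} {a : Fin n → ι} (ha : a ∉ Set.range (e ∘ · : (Fin n → Fin d) → Fin n → ι)) :
    tensorVec n (phaseState e z) a = 0 := by
  obtain ⟨k, hk⟩ : ∃ k, a k ∉ Set.range e := by
    by_contra! h
    choose b hb using h
    exact ha ⟨b, funext hb⟩
  exact Finset.prod_eq_zero (Finset.mem_univ k) (Function.extend_apply' _ _ _ hk)

lemma one_div_sqrt_mul_self (d : ℕ) :
    (1 / Real.sqrt d : ℂ) * star (1 / Real.sqrt d : ℂ) = 1 / (d : ℂ) := by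
  rw [← Complex.ofReal_one, ← Complex.ofReal_div, Complex.star_def, Complex.conj_ofReal,
    ← Complex.ofReal_mul, div_mul_div_comm, one_mul, Real.mul_self_sqrt (Nat.cast_nonneg _)]
  simp

lemma star_phaseState_dotProduct_self {ι : Type*} [Fintype ι] {d : ℕ} (hd : 0 < d) {e : Fin d → ι}
    (he : Function.Injective e) {z : Fin d → ℂ} (hz : ∀ i, ‖z i‖ = 1) :
    star (phaseState e z) ⬝ᵥ phaseState e z = 1 := by
  rw [dotProduct, ← Fintype.sum_of_injective e he (fun _ => 1 / (d : ℂ))]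
  · simp [hd.ne']
  · intro x hx
    simp [phaseState, Function.extend_apply' _ _ _ hx]
  · intro i
    rw [Pi.star_apply, phaseState, he.extend_apply, star_mul', mul_mul_mul_comm,
      mul_comm (star (1 / _ : ℂ)), one_div_sqrt_mul_self, Complex.star_def, Complex.conj_mul', hz]
    simp

/-- The pure state `d^{-n/2} ∑ₐ |e ∘ a⟩ ⊗ |type of a⟩`, from which Bob can prepare `n` copies of
phase states: in `n` copies of the phase state of `z`, the amplitude
`d^{-n/2} ∏ᵢ zᵢ ^ (type of a)ᵢ` of `|e ∘ a⟩` depends on the sequence `a` through its type only,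
and all entries of a type are at most `n`. -/
noncomputable def typeEntangledState {ι : Type*} {d : ℕ} (e : Fin d → ι) (n : ℕ) :
    (Fin n → ι) × (Fin d → Fin (n + 1)) → ℂ := fun x =>
  Function.extend (e ∘ · : (Fin n → Fin d) → Fin n → ι)
    (fun a => if (fun i => (⟨seqType a i, Nat.lt_succ_of_le (seqType_le a i)⟩ : Fin (n + 1))) = x.2
      then (1 / Real.sqrt d : ℂ) ^ n else 0) 0 x.1

lemma sum_typeEntangledState_mul_star {ι : Type*} [Fintype ι] {d : ℕ} (hd : 0 < d) {e : Fin d → ι}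
    (he : Function.Injective e) (n : ℕ) :
    ∑ x, typeEntangledState e n x * star (typeEntangledState e n x) = 1 := by
  classical
  rw [Fintype.sum_prod_type, ← Fintype.sum_of_injective
    (e ∘ · : (Fin n → Fin d) → Fin n → ι) he.comp_left (fun _ => (1 / (d : ℂ)) ^ n)]
  · simp [hd.ne']
  · intro a ha
    simp [typeEntangledState, Function.extend_apply' _ _ _ ha]
  · intro a
    simp only [typeEntangledState, he.comp_left.extend_apply]
    simp only [apply_ite star, star_zero, mul_ite, ite_mul, zero_mul, mul_zero,
      Finset.sum_ite_eq, Finset.mem_univ, if_true, star_pow]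
    rw [← mul_pow, one_div_sqrt_mul_self]

lemma sum_typeEntangledState_mul {ι : Type*} {d : ℕ} {e : Fin d → ι} (he : Function.Injective e)
    (n : ℕ) (z : Fin d → ℂ) (a : Fin n → ι) :
    ∑ b, typeEntangledState e n (a, b) * ∏ i, z i ^ (b i : ℕ) =
      tensorVec n (phaseState e z) a := by
  classical
  by_cases ha : a ∈ Set.range (e ∘ · : (Fin n → Fin d) → Fin n → ι)
  · obtain ⟨a, rfl⟩ := ha
    simp only [typeEntangledState, he.comp_left.extend_apply]
    rw [tensorVec_phaseState_comp he]
    simp only [ite_mul, zero_mul, Finset.sum_ite_eq, Finset.mem_univ, if_true]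
  · rw [tensorVec_phaseState_of_notMem_range e z ha]
    simp [typeEntangledState, Function.extend_apply' _ _ _ ha]

/-! ### Discrete phases -/

section Phases

variable {d n m : ℕ}

open ZMod

/-- The cyclic group `ℤ/N` with `N = (n + 1) (m + 1)`, which labels the `N`-th roots of unity. It
has a subgroup of order `n + 1`, the multiples of `m + 1`, and its characters tell the exponents
`0, …, m` apart. -/
abbrev PhaseGroup (n m : ℕ) : Type := ZMod ((n + 1) * (m + 1))

/-- The phases `e^{2πi tᵢ / N}` with `N = (n + 1) (m + 1)`. -/
noncomputable def phases (t : Fin d → PhaseGroup n m) : Fin d → ℂ :=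
  fun i => stdAddChar (t i)

/-- The embedding of `{0, …, n}^d` as the subgroup of multiples of `m + 1`: on the level of phases,
the vectors of `(n + 1)`-th roots of unity. -/
def coarseShift (k : Fin d → Fin (n + 1)) : Fin d → PhaseGroup n m :=
  fun i => ((m + 1 : ℕ) : PhaseGroup n m) * ((k i : ℕ) : PhaseGroup n m)

lemma norm_phases (t : Fin d → PhaseGroup n m) (i : Fin d) : ‖phases t i‖ = 1 := by
  exact Circle.norm_coe _

lemma star_stdAddChar_pow_mul_pow {N : ℕ} [NeZero N] (y : ZMod N) (p q : ℕ) :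
    star (stdAddChar y) ^ p * stdAddChar y ^ q =
      stdAddChar (y * ((q : ZMod N) - (p : ZMod N))) := by
  have h : star (stdAddChar y) = stdAddChar (-y) := by
    rw [stdAddChar_apply, stdAddChar_apply, AddChar.map_neg_eq_inv, Circle.coe_inv_eq_conj]
    rfl
  rw [h, ← AddChar.map_nsmul_eq_pow, ← AddChar.map_nsmul_eq_pow, ← AddChar.map_add_eq_mul]
  congr 1
  simp only [nsmul_eq_mul]
  ring

/-- Multiplication by `m + 1` embeds `ℤ/(n + 1)` into `ℤ/(n + 1)(m + 1)`. -/
lemma succ_mul_sub_eq_zero_iff (p q : ℕ) :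
    ((m + 1 : ℕ) : PhaseGroup n m) * ((q : PhaseGroup n m) - (p : PhaseGroup n m)) = 0 ↔
      (p : ZMod (n + 1)) = q := by
  have h : ((m + 1 : ℕ) : PhaseGroup n m) * ((q : PhaseGroup n m) - (p : PhaseGroup n m)) =
      (((m + 1 : ℕ) * ((q : ℤ) - p) : ℤ) : PhaseGroup n m) := by
    push_cast
    ring
  rw [h, ZMod.intCast_zmod_eq_zero_iff_dvd, Nat.cast_mul, mul_comm, mul_dvd_mul_iff_left
    (by positivity), ← ZMod.intCast_zmod_eq_zero_iff_dvd]
  push_cast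
  rw [sub_eq_zero, eq_comm]

lemma sum_stdAddChar_mul_sub {p q : ℕ} (hp : p ≤ m) (hq : q ≤ m) (hpq : p ≠ q) :
    ∑ y : PhaseGroup n m, stdAddChar (y * ((q : PhaseGroup n m) - (p : PhaseGroup n m))) = 0 := by
  rw [AddChar.sum_mulShift _ (isPrimitive_stdAddChar _), if_neg, Nat.cast_zero]
  rw [sub_eq_zero, ZMod.natCast_eq_natCast_iff', Nat.mod_eq_of_lt, Nat.mod_eq_of_lt]
  · exact hpq.symm
  all_goals nlinarith [Nat.zero_le (n * (m + 1))]

/-- The monomials of exponents at most `n` in each variable are orthogonal on every coset of the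
group of vectors of `(n + 1)`-th roots of unity. -/
lemma sum_coarseShift_eq (t : Fin d → PhaseGroup n m) (b b' : Fin d → Fin (n + 1)) :
    ∑ k : Fin d → Fin (n + 1), (∏ i, star (phases (t + coarseShift k) i) ^ (b i : ℕ)) *
      ∏ i, phases (t + coarseShift k) i ^ (b' i : ℕ) = if b = b' then ((n + 1) ^ d : ℂ) else 0 := by
  have hk (k : Fin d → Fin (n + 1)) : (∏ i, star (phases (t + coarseShift k) i) ^ (b i : ℕ)) *
      ∏ i, phases (t + coarseShift k) i ^ (b' i : ℕ) =
      ∏ i, (stdAddChar (t i * (((b' i : ℕ) : PhaseGroup n m) - ((b i : ℕ) : PhaseGroup n m))) *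
        stdAddChar (((m + 1 : ℕ) : PhaseGroup n m) *
          (((b' i : ℕ) : PhaseGroup n m) - ((b i : ℕ) : PhaseGroup n m))) ^ (k i : ℕ)) := by
    rw [← Finset.prod_mul_distrib]
    refine Finset.prod_congr rfl fun i _ => ?_
    rw [phases, star_stdAddChar_pow_mul_pow, ← AddChar.map_nsmul_eq_pow, ← AddChar.map_add_eq_mul]
    congr 1
    simp only [Pi.add_apply, coarseShift, nsmul_eq_mul]
    ring
  simp only [hk]
  rw [← Fintype.prod_sum fun (i : Fin d) (x : Fin (n + 1)) =>
    stdAddChar (t i * (((b' i : ℕ) : PhaseGroup n m) - ((b i : ℕ) : PhaseGroup n m))) *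
        stdAddChar (((m + 1 : ℕ) : PhaseGroup n m) *
          (((b' i : ℕ) : PhaseGroup n m) - ((b i : ℕ) : PhaseGroup n m))) ^ (x : ℕ)]
  split_ifs with h
  · subst h
    simp
  · obtain ⟨i, hi⟩ := Function.ne_iff.1 h
    refine Finset.prod_eq_zero (Finset.mem_univ i) ?_
    rw [← Finset.mul_sum, Fin.sum_univ_eq_sum_range fun x : ℕ =>
      stdAddChar (((m + 1 : ℕ) : PhaseGroup n m) *
          (((b' i : ℕ) : PhaseGroup n m) - ((b i : ℕ) : PhaseGroup n m))) ^ x]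
    set x := stdAddChar (((m + 1 : ℕ) : PhaseGroup n m) *
          (((b' i : ℕ) : PhaseGroup n m) - ((b i : ℕ) : PhaseGroup n m))) with hx
    have hx1 : x ≠ 1 := by
      rw [hx, ← AddChar.map_zero_eq_one (stdAddChar (N := (n + 1) * (m + 1))), Ne,
        injective_stdAddChar.eq_iff, succ_mul_sub_eq_zero_iff,
        ZMod.natCast_eq_natCast_iff', Nat.mod_eq_of_lt (b i).2,
        Nat.mod_eq_of_lt (b' i).2]
      exact fun h => hi (Fin.ext h)
    have hxn : x ^ (n + 1) = 1 := by
      rw [hx, ← AddChar.map_nsmul_eq_pow,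
        ← AddChar.map_zero_eq_one (stdAddChar (N := (n + 1) * (m + 1))), nsmul_eq_mul,
        ← mul_assoc, ← Nat.cast_mul, ZMod.natCast_self, zero_mul]
    -- the factor at `i` is a geometric sum over the powers of `x ≠ 1` with `x ^ (n + 1) = 1`
    have := mul_geom_sum x (n + 1)
    rw [hxn, sub_self, mul_eq_zero] at this
    rw [this.resolve_left (sub_ne_zero.2 hx1), mul_zero]

lemma prod_star_phases_add_coarseShift (t : Fin d → PhaseGroup n m)
    (k : Fin d → Fin (n + 1)) {α β : Fin d → ℕ} (h : residue n α = residue n β) :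
    (∏ i, star (phases (t + coarseShift k) i) ^ α i) * ∏ i, phases (t + coarseShift k) i ^ β i =
      (∏ i, star (phases t i) ^ α i) * ∏ i, phases t i ^ β i := by
  rw [← Finset.prod_mul_distrib, ← Finset.prod_mul_distrib]
  refine Finset.prod_congr rfl fun i _ => ?_
  rw [phases, phases, star_stdAddChar_pow_mul_pow, star_stdAddChar_pow_mul_pow]
  congr 1
  have hi := (succ_mul_sub_eq_zero_iff (n := n) (m := m) (α i) (β i)).2 (congrFun h i)
  rw [Pi.add_apply, coarseShift]
  linear_combination ((k i : ℕ) : PhaseGroup n m) * hi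

lemma sum_prod_star_phases_eq_zero {α β : Fin d → ℕ} (hα : ∀ i, α i ≤ m) (hβ : ∀ i, β i ≤ m)
    (h : α ≠ β) :
    ∑ t : Fin d → PhaseGroup n m,
      (∏ i, star (phases t i) ^ α i) * ∏ i, phases t i ^ β i = 0 := by
  simp only [← Finset.prod_mul_distrib, phases, star_stdAddChar_pow_mul_pow]
  rw [← Fintype.prod_sum fun (i : Fin d) (y : PhaseGroup n m) =>
    stdAddChar (y * ((β i : PhaseGroup n m) - (α i : PhaseGroup n m)))]
  obtain ⟨i, hi⟩ := Function.ne_iff.1 h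
  exact Finset.prod_eq_zero (Finset.mem_univ i) (sum_stdAddChar_mul_sub (hα i) (hβ i) hi)

end Phases

/-! ### The bound for phase states -/

section Bound

variable {ι : Type*} [Fintype ι] [DecidableEq ι] {S : Set (ι → ℂ)} {d n m : ℕ} {e : Fin d → ι}

/-- The average of the oracle's output over a coset of the group of vectors of `(n + 1)`-th roots of
unity does not depend on the coset: Bob steers to either ensemble from the same shared state by
measuring in a shifted Fourier basis. -/
lemma CloningOracle.NoSignalling.sum_R_coarseShift_eq (hd : 0 < d) (he : Function.Injective e)
    (hS : ∀ z : Fin d → ℂ, (∀ i, ‖z i‖ = 1) → phaseState e z ∈ S)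
    {C : CloningOracle S n m} (hC : C.NoSignalling) (t t' : Fin d → PhaseGroup n m) :
    ∑ k, C.R (copies n (phaseState e (phases (t + coarseShift k)))) =
      ∑ k, C.R (copies n (phaseState e (phases (t' + coarseShift k)))) := by
  set c : ℂ := (1 / Real.sqrt ((n + 1) ^ d : ℕ) : ℂ) with hc
  have hc0 : c ≠ 0 := by
    rw [hc]
    simp only [one_div, ne_eq, inv_eq_zero, Complex.ofReal_eq_zero]
    positivity
  let g (t : Fin d → PhaseGroup n m) (k : Fin d → Fin (n + 1))
      (b : Fin d → Fin (n + 1)) : ℂ := c * ∏ i, star (phases (t + coarseShift k) i) ^ (b i : ℕ)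
  have hg (t) : ∑ k, proj (g t k) = 1 := by
    ext b b'
    have h := sum_coarseShift_eq t b b'
    have hcc : c * star c = 1 / ((n + 1) ^ d : ℕ) := one_div_sqrt_mul_self _
    have hterm (k) : proj (g t k) b b' =
        c * star c * ((∏ i, star (phases (t + coarseShift k) i) ^ (b i : ℕ)) *
          ∏ i, phases (t + coarseShift k) i ^ (b' i : ℕ)) := by
      simp only [proj, g, vecMulVec_apply, Pi.star_apply, star_mul', star_prod, star_pow, star_star]
      ring
    rw [Matrix.sum_apply]
    simp only [hterm]
    rw [← Finset.mul_sum, h, hcc, one_apply]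
    split_ifs
    · push_cast
      rw [one_div_mul_cancel (by positivity)]
    · rw [mul_zero]
  have hcs : star c = c := by
    rw [hc, ← Complex.ofReal_one, ← Complex.ofReal_div, Complex.star_def, Complex.conj_ofReal]
  have hgψ (t) (k : Fin d → Fin (n + 1)) (a : Fin n → ι) :
      ∑ b, typeEntangledState e n (a, b) * star (g t k b) =
        c * tensorVec n (phaseState e (phases (t + coarseShift k))) a := by
    rw [← sum_typeEntangledState_mul he, Finset.mul_sum]
    refine Finset.sum_congr rfl fun b _ => ?_
    simp only [g, star_mul', star_prod, star_pow, star_star, hcs]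
    ring
  exact hC.sum_R_eq (sum_typeEntangledState_mul_star hd he n) (hg t) (hg t')
    (fun k => hS _ (norm_phases _)) (fun k => hS _ (norm_phases _))
    (fun k => star_phaseState_dotProduct_self hd he (norm_phases _))
    (fun k => star_phaseState_dotProduct_self hd he (norm_phases _)) hc0 (hgψ t) (hgψ t')

/-- The average over all discrete phases of the oracle's output on `n` copies, restricted to the
span of the `|e ∘ a⟩` and with the phases of the `m` target copies undone (up to the number of the
phases, which is not divided out). -/
noncomputable def CloningOracle.twirl (C : CloningOracle S n m) (e : Fin d → ι) :
    Matrix (Fin m → Fin d) (Fin m → Fin d) ℂ :=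
  ∑ t : Fin d → PhaseGroup n m,
    (diagonal fun a => ∏ i, phases t i ^ seqType a i)ᴴ *
      (C.R (copies n (phaseState e (phases t)))).submatrix (e ∘ ·) (e ∘ ·) *
        diagonal fun a => ∏ i, phases t i ^ seqType a i

lemma CloningOracle.twirl_apply (C : CloningOracle S n m) (e : Fin d → ι)
    (a b : Fin m → Fin d) : C.twirl e a b = ∑ t : Fin d → PhaseGroup n m,
      ((∏ i, star (phases t i) ^ seqType a i) * ∏ i, phases t i ^ seqType b i) *
        C.R (copies n (phaseState e (phases t))) (e ∘ a) (e ∘ b) := by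
  rw [twirl, Matrix.sum_apply]
  refine Finset.sum_congr rfl fun t _ => ?_
  rw [diagonal_conjTranspose, mul_diagonal, diagonal_mul, submatrix_apply]
  simp only [Pi.star_apply, star_prod, star_pow]
  ring

lemma CloningOracle.posSemidef_twirl
    (hS : ∀ z : Fin d → ℂ, (∀ i, ‖z i‖ = 1) → phaseState e z ∈ S) (C : CloningOracle S n m) :
    (C.twirl e).PosSemidef :=
  posSemidef_sum _ fun t _ => PosSemidef.conjTranspose_mul_mul_same
    ((C.R_isDensity _ (hS _ (norm_phases t))).1.submatrix _) _

lemma CloningOracle.re_trace_twirl_le (he : Function.Injective e)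
    (hS : ∀ z : Fin d → ℂ, (∀ i, ‖z i‖ = 1) → phaseState e z ∈ S) (C : CloningOracle S n m) :
    (C.twirl e).trace.re ≤ Fintype.card (Fin d → PhaseGroup n m) := by
  simp only [trace, diag_apply, C.twirl_apply]
  rw [Finset.sum_comm, Complex.re_sum, ← nsmul_one, ← Finset.card_univ, ← Finset.sum_const]
  refine Finset.sum_le_sum fun t _ => ?_
  obtain ⟨hpos, htr⟩ := C.R_isDensity _ (hS _ (norm_phases t))
  have h1 (a : Fin m → Fin d) :
      (∏ i, star (phases t i) ^ seqType a i) * ∏ i, phases t i ^ seqType a i = 1 := by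
    rw [← Finset.prod_mul_distrib]
    refine Finset.prod_eq_one fun i _ => ?_
    rw [← mul_pow, Complex.star_def, Complex.conj_mul', norm_phases]
    simp
  simp only [h1, one_mul]
  have h2 := congrArg Complex.re htr
  rw [trace, Complex.re_sum, Complex.one_re] at h2
  rw [Complex.re_sum, ← h2]
  simp only [diag_apply]
  rw [← Finset.sum_image (s := Finset.univ) (g := (e ∘ · : (Fin m → Fin d) → Fin m → ι))
    (f := fun x => (C.R (copies n (phaseState e (phases t))) x x).re) he.comp_left.injOn]
  exact Finset.sum_le_sum_of_subset_of_nonneg (Finset.subset_univ _)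
    fun x _ _ => (Complex.nonneg_iff.1 (hpos.diag_nonneg (i := x))).1

/-- No-signalling makes the average lose its coherences between different types in the same residue
class: on each coset of the `(n + 1)`-th roots of unity the relative phase of the two types is
constant, so that only the coset average of the output matters; this does not depend on the coset,
while the relative phase averages to zero over the cosets. -/
lemma CloningOracle.NoSignalling.twirl_apply_eq_zero (hd : 0 < d) (he : Function.Injective e)
    (hS : ∀ z : Fin d → ℂ, (∀ i, ‖z i‖ = 1) → phaseState e z ∈ S)
    {C : CloningOracle S n m} (hC : C.NoSignalling) {a b : Fin m → Fin d}
    (hres : residue n (seqType a) = residue n (seqType b)) (hne : seqType a ≠ seqType b) :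
    C.twirl e a b = 0 := by
  have hshift (k : Fin d → Fin (n + 1)) : C.twirl e a b =
      ∑ t : Fin d → PhaseGroup n m,
        ((∏ i, star (phases t i) ^ seqType a i) * ∏ i, phases t i ^ seqType b i) *
          C.R (copies n (phaseState e (phases (t + coarseShift k)))) (e ∘ a) (e ∘ b) := by
    rw [C.twirl_apply, ← Equiv.sum_comp (Equiv.addRight (coarseShift k))]
    refine Finset.sum_congr rfl fun t _ => ?_
    rw [Equiv.coe_addRight, prod_star_phases_add_coarseShift t k hres]
  have hsum : (Fintype.card (Fin d → Fin (n + 1)) : ℂ) * C.twirl e a b = 0 := by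
    rw [← nsmul_eq_mul, ← Finset.card_univ, ← Finset.sum_const,
      Finset.sum_congr rfl fun k _ => hshift k, Finset.sum_comm]
    have hA (t : Fin d → PhaseGroup n m) :
        ∑ k, C.R (copies n (phaseState e (phases (t + coarseShift k)))) (e ∘ a) (e ∘ b) =
          ∑ k, C.R (copies n (phaseState e (phases ((0 : Fin d → PhaseGroup n m) + coarseShift k))))
            (e ∘ a) (e ∘ b) := by
      rw [← Matrix.sum_apply, ← Matrix.sum_apply, hC.sum_R_coarseShift_eq hd he hS t 0]
    simp only [← Finset.mul_sum, hA]
    rw [← Finset.sum_mul, sum_prod_star_phases_eq_zero (seqType_le a) (seqType_le b) hne, zero_mul]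
  exact (mul_eq_zero.1 hsum).resolve_left (Nat.cast_ne_zero.2 Fintype.card_ne_zero)

/-- The sum of the fidelities over all discrete phases is the sum of all entries of the averaged
output, up to normalization. -/
lemma CloningOracle.sum_fidelity_eq (hd : 0 < d) (he : Function.Injective e)
    (hS : ∀ z : Fin d → ℂ, (∀ i, ‖z i‖ = 1) → phaseState e z ∈ S) (C : CloningOracle S n m) :
    ∑ t : Fin d → PhaseGroup n m, fidelity (C.R (copies n (phaseState e (phases t))))
        (copies m (phaseState e (phases t))) =
      1 / (d : ℝ) ^ m * (∑ a, ∑ b, C.twirl e a b).re := by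
  have hsum (F : (Fin m → ι) → ℂ)
      (hF : ∀ x ∉ Set.range (e ∘ · : (Fin m → Fin d) → Fin m → ι), F x = 0) :
      ∑ x, F x = ∑ a : Fin m → Fin d, F (e ∘ a) :=
    (Fintype.sum_of_injective _ he.comp_left _ F hF fun _ => rfl).symm
  have hterm (t : Fin d → PhaseGroup n m) :
      star (tensorVec m (phaseState e (phases t))) ⬝ᵥ
        C.R (copies n (phaseState e (phases t))) *ᵥ tensorVec m (phaseState e (phases t)) =
      ((1 / (d : ℝ) ^ m : ℝ) : ℂ) * ∑ a : Fin m → Fin d, ∑ b : Fin m → Fin d,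
        ((∏ i, star (phases t i) ^ seqType a i) * ∏ i, phases t i ^ seqType b i) *
          C.R (copies n (phaseState e (phases t))) (e ∘ a) (e ∘ b) := by
    have hdm : ((1 / (d : ℝ) ^ m : ℝ) : ℂ) =
        (1 / Real.sqrt d : ℂ) ^ m * star (1 / Real.sqrt d : ℂ) ^ m := by
      rw [← mul_pow, one_div_sqrt_mul_self]
      push_cast
      rw [_root_.one_div_pow]
    simp only [dotProduct, mulVec]
    rw [hsum _ fun x hx => by
      rw [Pi.star_apply, tensorVec_phaseState_of_notMem_range e _ hx, star_zero, zero_mul],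
      Finset.mul_sum]
    refine Finset.sum_congr rfl fun a _ => ?_
    rw [hsum _ fun x hx => by
      rw [tensorVec_phaseState_of_notMem_range e _ hx, mul_zero], Finset.mul_sum, Finset.mul_sum]
    refine Finset.sum_congr rfl fun b _ => ?_
    rw [hdm, Pi.star_apply, tensorVec_phaseState_comp he, tensorVec_phaseState_comp he, star_mul',
      star_prod, star_pow]
    simp only [star_pow]
    ring
  have hfid (t : Fin d → PhaseGroup n m) :
      fidelity (C.R (copies n (phaseState e (phases t)))) (copies m (phaseState e (phases t))) =
      1 / (d : ℝ) ^ m * (∑ a : Fin m → Fin d, ∑ b : Fin m → Fin d,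
        ((∏ i, star (phases t i) ^ seqType a i) * ∏ i, phases t i ^ seqType b i) *
          C.R (copies n (phaseState e (phases t))) (e ∘ a) (e ∘ b)).re := by
    rw [copies_eq_proj m, fidelity_proj (C.R_isDensity _ (hS _ (norm_phases t))).1
      (star_tensorVec_dotProduct_self m (star_phaseState_dotProduct_self hd he (norm_phases t))),
      hterm, Complex.re_ofReal_mul]
  simp only [hfid]
  rw [← Finset.mul_sum, ← Complex.re_sum]
  simp only [C.twirl_apply]
  congr 2
  exact Finset.sum_comm_cycle.symm

/-- The fidelity bound for every set of states that contains all phase states with respect to some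
orthonormal system `|e i⟩`. -/
theorem CloningOracle.NoSignalling.worstCaseFidelity_le (hd : 0 < d) (he : Function.Injective e)
    (hS : ∀ z : Fin d → ℂ, (∀ i, ‖z i‖ = 1) → phaseState e z ∈ S)
    {C : CloningOracle S n m} (hC : C.NoSignalling)
    {B : (Fin d → ZMod (n + 1)) → Fin d → ℕ} (hB : IsArgmaxSelection n m B) :
    C.worstCaseFidelity ≤ ∑ ν ∈ residues d n m, 1 / (d : ℝ) ^ m * multinom m (B ν) := by
  have hmem (a : Fin m → Fin d) : residue n (seqType a) ∈ residues d n m :=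
    Finset.mem_image_of_mem _ (by simp [Finset.mem_piAntidiag, sum_seqType])
  have hw (ν) : 0 < multinom m (B ν) := div_pos (by positivity) (by positivity)
  have htw := (C.posSemidef_twirl hS).re_sum_sum_le_mul_trace seqType (residue n) (residues d n m)
    hmem (fun ν => multinom m (B ν)) (fun ν _ => hw ν)
    (fun a => by
      rw [card_seqType_eq (sum_seqType a)]
      exact (hB _ (hmem a)).2 _ ⟨sum_seqType a, rfl⟩)
    fun a b hres hne => hC.twirl_apply_eq_zero hd he hS hres hne
  -- the infimum is over a family that is bounded below by zero, so it is at most every member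
  have hinf (t : Fin d → PhaseGroup n m) : C.worstCaseFidelity ≤
      fidelity (C.R (copies n (phaseState e (phases t)))) (copies m (phaseState e (phases t))) :=
    ciInf_le (f := fun ψ : S => fidelity (C.R (copies n ψ.1)) (copies m ψ.1))
      ⟨0, Set.forall_mem_range.2 fun _ => sq_nonneg _⟩ ⟨_, hS _ (norm_phases t)⟩
  have hsum := Finset.sum_le_sum fun t (_ : t ∈ Finset.univ) => hinf t
  rw [C.sum_fidelity_eq hd he hS, Finset.sum_const, nsmul_eq_mul, Finset.card_univ] at hsum
  have hcard : (0 : ℝ) < Fintype.card (Fin d → PhaseGroup n m) :=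
    Nat.cast_pos.2 Fintype.card_pos
  rw [← Finset.mul_sum]
  refine le_of_mul_le_mul_left (hsum.trans ?_) hcard
  rw [mul_left_comm, mul_comm (Fintype.card _ : ℝ)]
  refine mul_le_mul_of_nonneg_left (htw.trans ?_) (by positivity)
  exact mul_le_mul_of_nonneg_left (C.re_trace_twirl_le he hS)
    (Finset.sum_nonneg fun ν _ => (hw ν).le)

end Bound

/-! ### Multi-phase states and Choi states of multi-phase unitaries -/

lemma exists_mem_Ico_exp_eq {z : ℂ} (hz : ‖z‖ = 1) :
    ∃ θ ∈ Set.Ico 0 (2 * Real.pi), Complex.exp (Complex.I * (θ : ℝ)) = z := by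
  refine ⟨toIcoMod Real.two_pi_pos 0 z.arg, by simpa using toIcoMod_mem_Ico Real.two_pi_pos 0 z.arg,
    ?_⟩
  have h := Complex.norm_mul_exp_arg_mul_I z
  rw [hz, Complex.ofReal_one, one_mul] at h
  rw [toIcoMod, ← h, mul_comm Complex.I]
  push_cast
  rw [Complex.exp_eq_exp_iff_exists_int]
  refine ⟨-toIcoDiv Real.two_pi_pos 0 z.arg, ?_⟩
  simp [zsmul_eq_mul, h]
  ring

lemma phaseState_mem_multiPhaseStates {d : ℕ} {z : Fin d → ℂ} (hz : ∀ i, ‖z i‖ = 1) :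
    phaseState id z ∈ multiPhaseStates d := by
  choose θ hθ hθz using fun i => exists_mem_Ico_exp_eq (hz i)
  refine ⟨θ, hθ, funext fun i => ?_⟩
  rw [hθz]
  exact Function.injective_id.extend_apply _ _ i

lemma phaseState_mem_multiPhaseChoiStates {d : ℕ} {z : Fin d → ℂ} (hz : ∀ i, ‖z i‖ = 1) :
    phaseState (fun i => (i, i)) z ∈ multiPhaseChoiStates d := by
  choose θ hθ hθz using fun i => exists_mem_Ico_exp_eq (hz i)
  refine ⟨_, ⟨θ, hθ, rfl⟩, funext fun ⟨i, j⟩ => ?_⟩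
  have hinj : Function.Injective fun i : Fin d => (i, i) := fun _ _ h => congrArg Prod.fst h
  rw [choiState, phaseState]
  by_cases hij : i = j
  · subst hij
    rw [hinj.extend_apply _ _ i, diagonal_apply_eq, hθz]
  · rw [diagonal_apply_ne _ hij, mul_zero, Function.extend_apply']
    · rfl
    · rintro ⟨k, hk⟩
      exact hij ((congrArg Prod.fst hk).symm.trans (congrArg Prod.snd hk))

end NoCloning

theorem mainTheorem5 (d n m : ℕ) (hd : 0 < d)
    (B : (Fin d → ZMod (n + 1)) → Fin d → ℕ) (hB : NoCloning.IsArgmaxSelection n m B) :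
    (∀ C : NoCloning.CloningOracle (NoCloning.multiPhaseStates d) n m, C.NoSignalling →
      C.worstCaseFidelity ≤
        ∑ ν ∈ NoCloning.residues d n m, 1 / (d : ℝ) ^ m * NoCloning.multinom m (B ν)) ∧
    (∀ C : NoCloning.CloningOracle (NoCloning.multiPhaseChoiStates d) n m, C.NoSignalling →
      C.worstCaseFidelity ≤
        ∑ ν ∈ NoCloning.residues d n m, 1 / (d : ℝ) ^ m * NoCloning.multinom m (B ν)) :=
  ⟨fun _ hC => hC.worstCaseFidelity_le hd Function.injective_id
      (fun _ => NoCloning.phaseState_mem_multiPhaseStates) hB,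
    fun _ hC => hC.worstCaseFidelity_le hd (fun _ _ h => congrArg Prod.fst h)
      (fun _ => NoCloning.phaseState_mem_multiPhaseChoiStates) hB⟩
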